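/- **Theorem 20.1 (Basterfield–Kelly).** Let $L$ be a finite geometric lattice of rank $d$, that is, a finite lattice in which every element is a join of points (elements covering $0$; the element $0$ is the empty join) and which is semimodular: whenever $a$ covers $a\wedge b$, the element $a\vee b$ covers $b$. The rank of an element is the maximum length of a chain ending at it (a chain of $n+1$ elements has length $n$), and $d$ is the rank of $1$. Let $W_k$ denote the number of elements of $L$ of rank $k$, so that for $d\ge 1$ the number of points is $W_1$ and the number of hyperplanes (elements covered by $1$) is $W_{d-1}$; for $d=0$ put $W_{-1}=0$. Then $W_1=W_{d-1}$ if and only if $L$ is modular, i.e. $a\vee(b\wedge c)=(a\vee b)\wedge c$ for all $a,b,c\in L$ with $a\le c$. -/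

import Mathlib

/-- A geometric lattice: a semimodular lattice (`b ⋖ a ⊔ b` whenever `a ⊓ b ⋖ a`) in which every
element is a join of points, that is, of atoms (the bottom element being the empty join). -/
class IsGeometricLattice (L : Type*) [Lattice L] [OrderBot L] : Prop
    extends IsUpperModularLattice L, IsAtomistic L

/-- The number `W_k` of elements of rank `k`. The rank of `x` is `Order.height x`, the maximal
length (number of steps) of a chain ending at `x`. The index is an integer, so that `W_{d-1}` also
makes sense for `d = 0`, where it counts nothing. -/
noncomputable def whitneyNumber (L : Type*) [Preorder L] (k : ℤ) : ℕ :=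
  Set.ncard {x : L | ∃ n : ℕ, (n : ℤ) = k ∧ Order.height x = (n : ℕ∞)}

/-!
By induction on the lattice, applied to the interval above a point `p`, there are at most as many
lines through `p` as hyperplanes through `p`. If `p` is not on the hyperplane `H`, then distinct
points of `H` span distinct lines with `p`, so `H` has at most as many points as there are
hyperplanes through `p`. The double counting of de Bruijn and Erdős now gives `W₁ ≤ W_{d-1}`, and
in the case of equality it makes these inequalities equalities, so that every line through `p` meets
`H`. A geometric lattice whose lines meet its hyperplanes is lower semimodular, hence modular.
Conversely, the dual of a modular geometric lattice is geometric, so that also `W_{d-1} ≤ W₁`.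
-/

/-! ### Double counting -/

section Incidence

variable {α β : Type*} [Finite α] [Finite β] {r : α → β → Prop} {a : α} {b : β}

open Finset in
/- Giving every related pair `(a, b)` the weight `1 / deg a` makes the weights add up to `card α`,
and the weights `1 / deg b` add up to `card β`. -/
theorem card_mul_degree_eq_card_mul_degree_of_le (hα : ∀ a, ∃ b, r a b) (hβ : ∀ b, ∃ a, r a b)
    (h : ∀ a b, r a b →
      Nat.card α * Nat.card {b' // r a b'} ≤ Nat.card β * Nat.card {a' // r a' b})
    (hab : r a b) :
    Nat.card α * Nat.card {b' // r a b'} = Nat.card β * Nat.card {a' // r a' b} := by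
  classical
  have := Fintype.ofFinite α
  have := Fintype.ofFinite β
  simp only [Nat.card_eq_fintype_card, Fintype.card_subtype] at *
  have degα_pos (a : α) : (0 : ℚ) < #{b | r a b} := by
    obtain ⟨b, hb⟩ := hα a
    exact_mod_cast card_pos.2 ⟨b, by simpa using hb⟩
  have degβ_pos (b : β) : (0 : ℚ) < #{a | r a b} := by
    obtain ⟨a, ha⟩ := hβ b
    exact_mod_cast card_pos.2 ⟨a, by simpa using ha⟩
  let f (x : α × β) : ℚ := if r x.1 x.2 then Fintype.card α / #{a | r a x.2} else 0
  let g (x : α × β) : ℚ := if r x.1 x.2 then Fintype.card β / #{b | r x.1 b} else 0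
  have sum_f : ∑ x, f x = Fintype.card β * Fintype.card α := by
    have (b : β) : ∑ a, f (a, b) = Fintype.card α := by
      simp only [f, ← sum_filter, sum_const, nsmul_eq_mul]
      exact mul_div_cancel₀ _ (degβ_pos b).ne'
    simp only [Fintype.sum_prod_type_right, this, sum_const, card_univ, nsmul_eq_mul]
  have sum_g : ∑ x, g x = Fintype.card α * Fintype.card β := by
    have (a : α) : ∑ b, g (a, b) = Fintype.card β := by
      simp only [g, ← sum_filter, sum_const, nsmul_eq_mul]
      exact mul_div_cancel₀ _ (degα_pos a).ne'
    simp only [Fintype.sum_prod_type, this, sum_const, card_univ, nsmul_eq_mul]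
  have f_le_g : ∀ x ∈ univ, f x ≤ g x := by
    rintro ⟨a, b⟩ -
    by_cases hr : r a b
    · simp only [f, g, hr, if_true]
      rw [div_le_div_iff₀ (degβ_pos b) (degα_pos a)]
      exact_mod_cast h a b hr
    · simp only [f, g, hr, if_false, le_refl]
  have f_eq_g : f (a, b) = g (a, b) :=
    (sum_eq_sum_iff_of_le f_le_g).1 (by rw [sum_f, sum_g, mul_comm]) _ (mem_univ _)
  simp only [f, g, hab, if_true] at f_eq_g
  exact_mod_cast (div_eq_div_iff (degβ_pos b).ne' (degα_pos a).ne').1 f_eq_g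

theorem card_subtype_add_card_subtype_not (p : α → Prop) :
    Nat.card {a // p a} + Nat.card {a // ¬ p a} = Nat.card α := by
  classical
  rw [← Nat.card_sum, Nat.card_congr (Equiv.sumCompl p)]

theorem card_mul_degree_eq_card_mul_degree_of_not (hα : ∀ a, ∃ b, ¬ r a b)
    (hβ : ∀ b, ∃ a, ¬ r a b)
    (h : ∀ a b, ¬ r a b → Nat.card {a' // r a' b} ≤ Nat.card {b' // r a b'})
    (hle : Nat.card β ≤ Nat.card α) (hab : ¬ r a b) :
    Nat.card α * Nat.card {b' // r a b'} = Nat.card β * Nat.card {a' // r a' b} := by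
  have degree_add (a : α) := card_subtype_add_card_subtype_not (r a)
  have degree_add' (b : β) := card_subtype_add_card_subtype_not (r · b)
  have codegree_eq : Nat.card α * Nat.card {b' // ¬ r a b'} =
      Nat.card β * Nat.card {a' // ¬ r a' b} := by
    refine card_mul_degree_eq_card_mul_degree_of_le hα hβ (fun a b hr => ?_) hab
    nlinarith [Nat.mul_le_mul hle (h a b hr), degree_add a, degree_add' b]
  nlinarith [degree_add a, degree_add' b]

end Incidence

/-! ### Semimodular lattices -/

section Height

open Order

theorem height_eq_one_iff_isAtom {α : Type*} [PartialOrder α] [OrderBot α] {a : α} :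
    height a = 1 ↔ IsAtom a := by
  rw [← Nat.cast_one, height_eq_coe_iff_minimal_le_height, isAtom_iff_le_of_ge]
  simp [Minimal, Order.one_le_iff_ne_zero]

theorem coheight_eq_one_iff_isCoatom {α : Type*} [PartialOrder α] [OrderTop α] {a : α} :
    coheight a = 1 ↔ IsCoatom a :=
  height_eq_one_iff_isAtom (α := αᵒᵈ)

variable {L : Type*} [Lattice L] [IsUpperModularLattice L]

theorem covBy_sup_of_covBy_of_le_of_not_le {a c x : L} (hac : a ⋖ c) (hax : a ≤ x)
    (hcx : ¬ c ≤ x) : x ⋖ c ⊔ x := by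
  refine covBy_sup_of_inf_covBy_left ?_
  rwa [(hac.eq_or_eq (le_inf hac.le hax) inf_le_left).resolve_right fun h => hcx (inf_eq_left.1 h)]

theorem coheight_eq_coheight_add_one_of_covBy [IsStronglyAtomic L] [WellFoundedGT L] {a b : L}
    (hab : a ⋖ b) : coheight a = coheight b + 1 := by
  induction a using WellFoundedGT.induction generalizing b with
  | ind a ih =>
  have coheight_cover_le {c : L} (hac : a ⋖ c) : coheight c ≤ coheight b := by
    obtain rfl | hbc := eq_or_ne b c
    · rfl
    have hinf : b ⊓ c = a := hab.wcovBy.inf_eq hac.wcovBy hbc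
    rw [ih b hab.lt (covBy_sup_of_inf_covBy_right (hinf.symm ▸ hac)),
      ih c hac.lt (covBy_sup_of_inf_covBy_left (hinf.symm ▸ hab))]
  refine le_antisymm ?_ (coheight_add_one_le hab.lt)
  rw [coheight_eq_iSup_gt_coheight]
  refine iSup₂_le fun x hax => ?_
  obtain ⟨c, hac, hcx⟩ := exists_covBy_le_of_lt hax
  have := (coheight_anti hcx).trans (coheight_cover_le hac)
  gcongr

variable [BoundedOrder L] [WellFoundedLT L] [WellFoundedGT L]

theorem height_add_coheight_eq_height_top (a : L) : height a + coheight a = height (⊤ : L) := by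
  have height_top : height (⊤ : L) = ⨆ x : L, height x + coheight x := by
    have := krullDim_eq_iSup_height_add_coheight_of_nonempty (α := L)
    rw [← height_top_eq_krullDim] at this
    exact_mod_cast this
  refine le_antisymm (height_top ▸ le_iSup (fun x : L => height x + coheight x) a) ?_
  induction a using WellFoundedLT.induction with
  | ind a ih =>
  obtain rfl | hbot := eq_bot_or_bot_lt a
  · have : height (⊤ : L) = coheight (⊥ : L) := by
      exact_mod_cast (height_top_eq_krullDim (α := L)).trans coheight_bot_eq_krullDim.symm
    simp [this]
  · obtain ⟨c, -, hca⟩ := exists_le_covBy_of_lt hbot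
    calc height (⊤ : L) ≤ height c + coheight c := ih c hca.lt
      _ = height c + 1 + coheight a := by
        rw [coheight_eq_coheight_add_one_of_covBy hca, add_assoc, add_comm 1]
      _ ≤ height a + coheight a := by gcongr; exact height_add_one_le hca.lt

theorem isCoatom_iff_height_add_one_eq_height_top {a : L} (htop : height (⊤ : L) ≠ ⊤) :
    IsCoatom a ↔ height a + 1 = height (⊤ : L) := by
  have ha : height a ≠ ⊤ := ne_top_of_le_ne_top htop (height_mono le_top)
  rw [← coheight_eq_one_iff_isCoatom, ← height_add_coheight_eq_height_top a,
    (ENat.add_right_injective_of_ne_top ha).eq_iff, eq_comm]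

end Height

section Modular

variable {L : Type*} [Lattice L] [IsUpperModularLattice L] [IsLowerModularLattice L]
  [IsStronglyAtomic L] [WellFoundedGT L]

theorem eq_of_le_of_inf_eq_of_sup_eq {x y b : L} (hxy : x ≤ y) (hinf : x ⊓ b = y ⊓ b)
    (hsup : x ⊔ b = y ⊔ b) : x = y := by
  induction x using WellFoundedGT.induction generalizing y with
  | ind x ih =>
  obtain hbx | hbx := (inf_le_right : x ⊓ b ≤ b).eq_or_lt
  · refine hxy.antisymm (le_sup_left.trans (hsup.ge.trans ?_))
    exact sup_le le_rfl (inf_eq_right.1 hbx)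
  -- Pass from `x ≤ y` to `c ⊔ x ≤ c ⊔ y`, where `c` covers `x ⊓ b = y ⊓ b` inside `b`.
  obtain ⟨c, hc, hcb⟩ := exists_covBy_le_of_lt hbx
  have hcx : ¬ c ≤ x := fun h => hc.lt.not_ge (le_inf h hcb)
  have hcy : ¬ c ≤ y := fun h => hcx ((le_inf h hcb).trans (hinf.ge.trans inf_le_left))
  have hx : x ⋖ c ⊔ x := covBy_sup_of_covBy_of_le_of_not_le hc inf_le_left hcx
  have hy : y ⋖ c ⊔ y := covBy_sup_of_covBy_of_le_of_not_le (hinf ▸ hc) inf_le_left hcy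
  have hyb : y ⊓ b ⋖ (c ⊔ y) ⊓ b := by
    have hsup : y ⊔ (c ⊔ y) ⊓ b = c ⊔ y :=
      le_antisymm (sup_le le_sup_right inf_le_left)
        (sup_le ((le_inf le_sup_left hcb).trans le_sup_right) le_sup_left)
    have := inf_covBy_of_covBy_sup_left (a := y) (b := (c ⊔ y) ⊓ b) (hsup.symm ▸ hy)
    rwa [← inf_assoc, inf_eq_left.2 (le_sup_right : y ≤ c ⊔ y)] at this
  have hc_eq : c = (c ⊔ y) ⊓ b :=
    (hyb.eq_or_eq (hinf ▸ hc.le) (le_inf le_sup_left hcb)).resolve_left (hinf ▸ hc.lt.ne')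
  have hcxy : c ⊔ x = c ⊔ y := by
    refine ih _ hx.lt (sup_le_sup_left hxy c) ?_ (by rw [sup_assoc, hsup, sup_assoc])
    exact (inf_le_inf_right b (sup_le_sup_left hxy c)).antisymm
      (hc_eq.ge.trans (le_inf le_sup_left hcb))
  exact ((hx.eq_or_eq hxy (le_sup_right.trans hcxy.ge)).resolve_right
    fun h => hcy (h ▸ le_sup_left)).symm

theorem isModularLattice_of_isUpperModularLattice_of_isLowerModularLattice :
    IsModularLattice L where
  sup_inf_le_assoc_of_le {a} b {c} hac := by
    have hle : a ⊔ b ⊓ c ≤ (a ⊔ b) ⊓ c :=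
      sup_le (le_inf le_sup_left hac) (inf_le_inf_right c le_sup_right)
    refine (eq_of_le_of_inf_eq_of_sup_eq (b := b) hle ?_ ?_).ge
    · refine (inf_le_inf_right b hle).antisymm (le_inf ?_ inf_le_right)
      exact (le_inf inf_le_right (inf_le_left.trans inf_le_right)).trans le_sup_right
    · refine (sup_le_sup_right hle b).antisymm (sup_le ?_ le_sup_right)
      exact inf_le_left.trans (sup_le_sup_right le_sup_left b)

end Modular

/-! ### Points and hyperplanes -/

section Atomistic

variable {α : Type*} [PartialOrder α]

theorem isAtomistic_of_forall_atom_le_imp_le [OrderBot α]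
    (h : ∀ a b : α, (∀ p, IsAtom p → p ≤ a → p ≤ b) → a ≤ b) : IsAtomistic α where
  isLUB_atoms b :=
    ⟨{p | IsAtom p ∧ p ≤ b},
      ⟨fun _ hp => hp.2, fun c hc => h b c fun _ hp hpb => hc ⟨hp, hpb⟩⟩, fun _ hp => hp.1⟩

theorem exists_isAtom_le_not_le [OrderBot α] [IsAtomistic α] {a b : α} (h : ¬ a ≤ b) :
    ∃ p, IsAtom p ∧ p ≤ a ∧ ¬ p ≤ b := by
  by_contra! hab
  exact h (le_iff_atom_le_imp.2 hab)

theorem exists_isCoatom_le_not_le [OrderTop α] [IsCoatomistic α] {a b : α} (h : ¬ a ≤ b) :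
    ∃ H, IsCoatom H ∧ b ≤ H ∧ ¬ a ≤ H :=
  exists_isAtom_le_not_le (α := αᵒᵈ) h

end Atomistic

/-- The points of `L`, i.e. its elements of rank one. -/
abbrev Point (L : Type*) [PartialOrder L] [OrderBot L] : Type _ := {p : L // IsAtom p}

/-- The hyperplanes of `L`, i.e. the elements covered by `⊤`. -/
abbrev Hyperplane (L : Type*) [PartialOrder L] [OrderTop L] : Type _ := {H : L // IsCoatom H}

/-- Every line `c` meets every hyperplane `H`. This is trivial for the lines on `H`, so a point `p`
on `c` but not on `H` is given, and then `c` is spanned by `p` and the point of intersection `q`. -/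
def LinesMeetHyperplanes (L : Type*) [Lattice L] [BoundedOrder L] : Prop :=
  ∀ ⦃p : Point L⦄ ⦃H : Hyperplane L⦄ ⦃c : L⦄, ¬ p.1 ≤ H → p.1 ⋖ c →
    ∃ q : Point L, q.1 ≤ H ∧ q.1 ⊔ p = c

theorem exists_hyperplane_not_le {L : Type*} [PartialOrder L] [BoundedOrder L] [IsCoatomistic L]
    (p : Point L) : ∃ H : Hyperplane L, ¬ p.1 ≤ H :=
  let ⟨H, hH, _, hpH⟩ := exists_isCoatom_le_not_le fun h => p.2.1 (le_bot_iff.1 h)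
  ⟨⟨H, hH⟩, hpH⟩

theorem exists_point_not_le {L : Type*} [PartialOrder L] [BoundedOrder L] [IsAtomistic L]
    (H : Hyperplane L) : ∃ p : Point L, ¬ p.1 ≤ H :=
  let ⟨p, hp, _, hpH⟩ := exists_isAtom_le_not_le fun h => H.2.1 (top_le_iff.1 h)
  ⟨⟨p, hp⟩, hpH⟩

section Semimodular

variable {L : Type*} [Lattice L]

theorem sup_eq_of_covBy_of_le_of_not_le {a b p : L} (hab : a ⋖ b) (hpb : p ≤ b) (hpa : ¬ p ≤ a) :
    p ⊔ a = b :=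
  (hab.eq_or_eq le_sup_right (sup_le hpb hab.le)).resolve_left fun h => hpa (sup_eq_right.1 h)

variable [IsUpperModularLattice L]

instance isUpperModularLattice_Ici (a : L) : IsUpperModularLattice (Set.Ici a) where
  covBy_sup_of_inf_covBy {x y} h := by
    have coe_covBy_coe {x y : Set.Ici a} : (x : L) ⋖ y ↔ x ⋖ y := by
      refine Set.OrdConnected.apply_covBy_apply_iff (OrderEmbedding.subtype (· ∈ Set.Ici a)) ?_
      simpa only [OrderEmbedding.coe_subtype, Subtype.range_coe_subtype] using!
        Set.ordConnected_Ici (a := a)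
    exact coe_covBy_coe.1 (covBy_sup_of_inf_covBy_left (coe_covBy_coe.2 h))

variable [OrderBot L]

theorem covBy_sup_of_isAtom {p a : L} (hp : IsAtom p) (hpa : ¬ p ≤ a) : a ⋖ p ⊔ a :=
  covBy_sup_of_covBy_of_le_of_not_le hp.bot_covBy bot_le hpa

instance isAtomistic_Ici [IsAtomistic L] (a : L) : IsAtomistic (Set.Ici a) := by
  refine isAtomistic_of_forall_atom_le_imp_le fun x y h => le_iff_atom_le_imp (α := L).2 ?_
  intro p hp hpx
  by_cases hpa : p ≤ a
  · exact hpa.trans y.2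
  · have hatom : IsAtom (⟨p ⊔ a, le_sup_right⟩ : Set.Ici a) :=
      Set.Ici.isAtom_iff.2 (covBy_sup_of_isAtom hp hpa)
    exact le_sup_left.trans (h _ hatom (sup_le hpx x.2))

/-- The map `q ↦ q ⊔ p` from the points below `H` to the lines through a point `p` not below `H`.
A line through `p` is encoded as a point of the interval `[p, ⊤]`. -/
def joinPoint (p : Point L) {H : L} (hpH : ¬ p ≤ H) (q : {q : Point L // q.1 ≤ H}) :
    Point (Set.Ici p.1) :=
  ⟨⟨q.1 ⊔ p, le_sup_right⟩, Set.Ici.isAtom_iff.2 <| covBy_sup_of_isAtom q.1.2 fun hqp =>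
    hpH ((p.2.le_iff_eq q.1.2.1).1 hqp ▸ q.2)⟩

theorem joinPoint_injective (p : Point L) {H : L} (hpH : ¬ p ≤ H) :
    Function.Injective (joinPoint p hpH) := by
  rintro ⟨q, hqH⟩ ⟨q', hqH'⟩ h
  have hjoin : q.1 ⊔ p = q'.1 ⊔ p := congrArg (fun c => (c.1 : L)) h
  by_contra hne
  have hq'q : ¬ q'.1 ≤ q := fun hle =>
    hne (Subtype.ext (Subtype.ext ((q.2.le_iff_eq q'.2.1).1 hle).symm))
  have hcov : q.1 ⋖ p.1 ⊔ q := covBy_sup_of_isAtom p.2 fun hle => hpH (hle.trans hqH)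
  have hq'_le : q'.1 ≤ p.1 ⊔ q := by
    rw [sup_comm, hjoin]
    exact le_sup_left
  have hline : q'.1 ⊔ q = p.1 ⊔ q := sup_eq_of_covBy_of_le_of_not_le hcov hq'_le hq'q
  exact hpH ((le_sup_left.trans hline.ge).trans (sup_le hqH' hqH))

end Semimodular

section Geometric

variable {L : Type*} [Lattice L]

instance isGeometricLattice_Ici [OrderBot L] [IsGeometricLattice L] (a : L) :
    IsGeometricLattice (Set.Ici a) where

variable [BoundedOrder L]

theorem card_hyperplane_Ici (a : L) :
    Nat.card (Hyperplane (Set.Ici a)) = Nat.card {K : Hyperplane L // a ≤ K} :=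
  Nat.card_congr
    { toFun := fun K => ⟨⟨K.1, K.2.of_isCoatom_coe_Ici⟩, K.1.2⟩
      invFun := fun K => ⟨⟨K.1.1, K.2⟩, K.1.2.Ici K.2⟩
      left_inv := fun _ => rfl
      right_inv := fun _ => rfl }

variable [IsGeometricLattice L]

/- An element maximal among those above `a` but not above the atom `p` is a hyperplane: adding any
further point to it yields an element above `p`. -/
instance isCoatomistic_of_isGeometricLattice [WellFoundedGT L] : IsCoatomistic L := by
  rw [← isAtomistic_dual_iff_isCoatomistic]
  refine isAtomistic_of_forall_atom_le_imp_le fun (a b : L) h => ?_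
  change b ≤ a
  by_contra hba
  obtain ⟨p, hp, hpb, hpa⟩ := exists_isAtom_le_not_le hba
  obtain ⟨H, haH, hH⟩ := exists_maximal_ge_of_wellFoundedGT (fun H => ¬ p ≤ H) a hpa
  have sup_eq_top : p ⊔ H = ⊤ := by
    refine top_le_iff.1 (le_iff_atom_le_imp.2 fun s hs _ => ?_)
    by_cases hsH : s ≤ H
    · exact hsH.trans le_sup_right
    have hcov : H ⋖ s ⊔ H := covBy_sup_of_isAtom hs hsH
    have hps : p ≤ s ⊔ H := by
      by_contra hps
      exact hcov.lt.not_ge (hH.2 hps hcov.le)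
    exact le_sup_left.trans (sup_eq_of_covBy_of_le_of_not_le hcov hps hH.prop).ge
  have H_isCoatom : IsCoatom H := covBy_top_iff.1 (sup_eq_top ▸ covBy_sup_of_isAtom hp hH.prop)
  exact hH.prop (hpb.trans (h H H_isCoatom.dual haH))

theorem LinesMeetHyperplanes.isLowerModularLattice [WellFoundedGT L]
    (h : LinesMeetHyperplanes L) : IsLowerModularLattice L where
  inf_covBy_of_covBy_sup {a b} hab := by
    have hba : ¬ b ≤ a := fun hle => hab.lt.ne (sup_eq_left.2 hle).symm
    obtain ⟨H, hH, haH, hbH⟩ := exists_isCoatom_le_not_le hba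
    have hinf : (a ⊔ b) ⊓ H = a :=
      (hab.eq_or_eq (le_inf le_sup_left haH) inf_le_left).resolve_right
        fun he => hbH (le_sup_right.trans (inf_eq_left.1 he))
    have hbinf : b ⊓ H = a ⊓ b := by
      rw [← hinf, inf_right_comm, inf_eq_right.2 (le_sup_right : b ≤ a ⊔ b)]
    obtain ⟨p, hp, hpb, hpH⟩ := exists_isAtom_le_not_le hbH
    have hpinf : ¬ p ≤ a ⊓ b := fun hle => hpH ((hle.trans inf_le_left).trans haH)
    suffices b ≤ p ⊔ a ⊓ b by
      simpa only [this.antisymm' (sup_le hpb inf_le_right)] using covBy_sup_of_isAtom hp hpinf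
    refine le_iff_atom_le_imp.2 fun q hq hqb => ?_
    by_cases hqp : q ≤ p
    · exact hqp.trans le_sup_left
    obtain ⟨s, hsH, hs⟩ := h (p := ⟨p, hp⟩) (H := ⟨H, hH⟩) hpH (covBy_sup_of_isAtom hq hqp)
    have hsb : s ≤ b := le_sup_left.trans (hs.le.trans (sup_le hqb hpb))
    have hs_le : s ≤ a ⊓ b := (le_inf hsb hsH).trans hbinf.le
    exact le_sup_left.trans (hs.ge.trans (sup_le (hs_le.trans le_sup_right) le_sup_left))

variable [Finite L]

theorem card_point_le_card_hyperplane_through {p : Point L} {H : L} (hpH : ¬ p ≤ H)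
    (hp : Nat.card (Point (Set.Ici p.1)) ≤ Nat.card (Hyperplane (Set.Ici p.1))) :
    Nat.card {q : Point L // q.1 ≤ H} ≤ Nat.card {K : Hyperplane L // p.1 ≤ K} :=
  calc Nat.card {q : Point L // q.1 ≤ H}
      ≤ Nat.card (Point (Set.Ici p.1)) :=
        Nat.card_le_card_of_injective _ (joinPoint_injective p hpH)
    _ ≤ Nat.card (Hyperplane (Set.Ici p.1)) := hp
    _ = Nat.card {K : Hyperplane L // p.1 ≤ K} := card_hyperplane_Ici p.1

theorem card_point_mul_eq_card_hyperplane_mul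
    (hIci : ∀ p : Point L, Nat.card (Point (Set.Ici p.1)) ≤ Nat.card (Hyperplane (Set.Ici p.1)))
    (hle : Nat.card (Hyperplane L) ≤ Nat.card (Point L)) {p : Point L} {H : Hyperplane L}
    (hpH : ¬ p.1 ≤ H) :
    Nat.card (Point L) * Nat.card {K : Hyperplane L // p.1 ≤ K} =
      Nat.card (Hyperplane L) * Nat.card {q : Point L // q.1 ≤ H} :=
  card_mul_degree_eq_card_mul_degree_of_not (r := fun (p : Point L) (H : Hyperplane L) => p.1 ≤ H)
    exists_hyperplane_not_le exists_point_not_le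
    (fun p _ hpH => card_point_le_card_hyperplane_through hpH (hIci p)) hle hpH

theorem card_point_le_card_hyperplane (L : Type*) [Lattice L] [BoundedOrder L] [Finite L]
    [IsGeometricLattice L] : Nat.card (Point L) ≤ Nat.card (Hyperplane L) := by
  induction hn : Nat.card L using Nat.strong_induction_on generalizing L with
  | _ n ih =>
  subst hn
  have hIci (p : Point L) :
      Nat.card (Point (Set.Ici p.1)) ≤ Nat.card (Hyperplane (Set.Ici p.1)) :=
    ih _ (Finite.card_subtype_lt (x := ⊥) fun h => p.2.1 (le_bot_iff.1 h)) _ rfl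
  by_contra! hlt
  obtain ⟨p⟩ : Nonempty (Point L) := (Nat.card_pos_iff.1 (by lia)).1
  obtain ⟨H, hpH⟩ := exists_hyperplane_not_le p
  have : Nontrivial (Point L) := by
    have : 0 < Nat.card (Hyperplane L) := Nat.card_pos_iff.2 ⟨⟨H⟩, inferInstance⟩
    exact Finite.one_lt_card_iff_nontrivial.1 (by lia)
  have p_ne_top : p.1 ≠ ⊤ := by
    obtain ⟨q, hqp⟩ := exists_ne p
    exact fun h => hqp (Subtype.ext ((p.2.le_iff_eq q.2.1).1 (h ▸ le_top)))
  have through_pos : 0 < Nat.card {K : Hyperplane L // p.1 ≤ K} := by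
    obtain ⟨K, hK, hpK⟩ := (eq_top_or_exists_le_coatom p.1).resolve_left p_ne_top
    exact Nat.card_pos_iff.2 ⟨⟨⟨⟨K, hK⟩, hpK⟩⟩, inferInstance⟩
  refine (card_point_mul_eq_card_hyperplane_mul hIci hlt.le hpH).not_gt ?_
  calc Nat.card (Hyperplane L) * Nat.card {q : Point L // q.1 ≤ H}
      ≤ Nat.card (Hyperplane L) * Nat.card {K : Hyperplane L // p.1 ≤ K} := by
        gcongr
        exact card_point_le_card_hyperplane_through hpH (hIci p)
    _ < Nat.card (Point L) * Nat.card {K : Hyperplane L // p.1 ≤ K} := by gcongr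

theorem linesMeetHyperplanes_of_card_point_eq_card_hyperplane
    (h : Nat.card (Point L) = Nat.card (Hyperplane L)) : LinesMeetHyperplanes L := by
  intro p H c hpH hc
  have hIci (p : Point L) := card_point_le_card_hyperplane (Set.Ici p.1)
  have card_pos : 0 < Nat.card (Point L) := Nat.card_pos_iff.2 ⟨⟨p⟩, inferInstance⟩
  have degree_eq : Nat.card {K : Hyperplane L // p.1 ≤ K} = Nat.card {q : Point L // q.1 ≤ H} := by
    have := card_point_mul_eq_card_hyperplane_mul hIci h.ge hpH
    rw [← h] at this
    exact Nat.eq_of_mul_eq_mul_left card_pos this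
  have joinPoint_bijective : Function.Bijective (joinPoint p hpH) :=
    (joinPoint_injective p hpH).bijective_of_nat_card_le <|
      (hIci p).trans_eq ((card_hyperplane_Ici p.1).trans degree_eq)
  obtain ⟨q, hq⟩ := joinPoint_bijective.2 ⟨⟨c, hc.le⟩, Set.Ici.isAtom_iff.2 hc⟩
  exact ⟨q.1, q.2, congrArg (fun c => (c.1 : L)) hq⟩

theorem card_point_eq_card_hyperplane [IsLowerModularLattice L] :
    Nat.card (Point L) = Nat.card (Hyperplane L) := by
  have : IsGeometricLattice Lᵒᵈ := {}
  have points_dual : Nat.card (Point Lᵒᵈ) = Nat.card (Hyperplane L) :=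
    Nat.card_congr (OrderDual.ofDual.subtypeEquiv fun _ => isCoatom_dual_iff_isAtom.symm)
  have hyperplanes_dual : Nat.card (Hyperplane Lᵒᵈ) = Nat.card (Point L) :=
    Nat.card_congr (OrderDual.ofDual.subtypeEquiv fun _ => isAtom_dual_iff_isCoatom.symm)
  refine (card_point_le_card_hyperplane L).antisymm ?_
  rw [← points_dual, ← hyperplanes_dual]
  exact card_point_le_card_hyperplane Lᵒᵈ

end Geometric

section Whitney

theorem whitneyNumber_one {L : Type*} [PartialOrder L] [OrderBot L] :
    whitneyNumber L 1 = Nat.card (Point L) := by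
  rw [whitneyNumber, ← Nat.card_coe_set_eq]
  refine Nat.card_congr (Equiv.subtypeEquivRight fun a => ?_)
  rw [← height_eq_one_iff_isAtom]
  refine ⟨fun ⟨n, hn, ha⟩ => ?_, fun ha => ⟨1, rfl, by simpa using ha⟩⟩
  obtain rfl : n = 1 := by exact_mod_cast hn
  simpa using ha

theorem whitneyNumber_height_top_sub_one {L : Type*} [Lattice L] [BoundedOrder L]
    [IsUpperModularLattice L] [WellFoundedLT L] [WellFoundedGT L] {d : ℕ}
    (hd : Order.height (⊤ : L) = d) :
    whitneyNumber L ((d : ℤ) - 1) = Nat.card (Hyperplane L) := by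
  rw [whitneyNumber, ← Nat.card_coe_set_eq]
  refine Nat.card_congr (Equiv.subtypeEquivRight fun a => ?_)
  have htop : Order.height (⊤ : L) ≠ ⊤ := hd ▸ ENat.natCast_ne_top d
  have ha : Order.height a ≠ ⊤ := ne_top_of_le_ne_top htop (Order.height_mono le_top)
  obtain ⟨m, hm⟩ := ENat.ne_top_iff_exists.1 ha
  rw [isCoatom_iff_height_add_one_eq_height_top htop, hd]
  simp only [Set.mem_ofPred_eq, ← hm]
  norm_cast
  exact ⟨fun ⟨n, hn, hmn⟩ => by lia, fun h => ⟨m, by lia, rfl⟩⟩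

end Whitney

theorem theorem20p1 {L : Type*} [Lattice L] [BoundedOrder L] [Finite L] [IsGeometricLattice L]
    (d : ℕ) (hd : Order.height (⊤ : L) = (d : ℕ∞)) :
    whitneyNumber L 1 = whitneyNumber L ((d : ℤ) - 1) ↔ IsModularLattice L := by
  rw [whitneyNumber_one, whitneyNumber_height_top_sub_one hd]
  refine ⟨fun hcard => ?_, fun _ => card_point_eq_card_hyperplane⟩
  have : IsLowerModularLattice L :=
    (linesMeetHyperplanes_of_card_point_eq_card_hyperplane hcard).isLowerModularLattice
  exact isModularLattice_of_isUpperModularLattice_of_isLowerModularLattice
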